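/- Let $K$ be an algebraically closed field of arbitrary characteristic, and let $M$ be an affine algebraic monoid over $K$, i.e. an affine variety over $K$ (not necessarily irreducible) with an associative product $M\times M\to M$ that is a morphism of varieties and has an identity element. Then there is a finite-dimensional vector space $A$ over $K$ with a bilinear product $A\times A\to A$ (not necessarily associative, commutative or unital) such that $$\operatorname{End}(A)\cong M\sqcup\{\mathfrak z\}$$ as algebraic monoids (that is, by an isomorphism of monoids which is also an isomorphism of varieties). Here $\operatorname{End}(A)$ is the monoid under composition of all linear maps $\phi\colon A\to A$ with $\phi(ab)=\phi(a)\phi(b)$ for all $a,b\in A$, a Zariski closed submonoid of the monoid of all linear operators on $A$; $M\sqcup\{\mathfrak z\}$ is the disjoint union of the variety $M$ with a point $\mathfrak z$, with the product of $M$ extended by $\mathfrak z x=x\mathfrak z=\mathfrak z$ for all $x$; and the isomorphism sends $\mathfrak z$ to the zero endomorphism of $A$. Moreover, the zero endomorphism is an isolated point of $\operatorname{End}(A)$ in the Zariski topology, and it forms by itself both an irreducible component and a connected component of $\operatorname{End}(A)$. -/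

import Mathlib

universe u v w

namespace AffMon

/-- The evaluation homomorphism at a point `x`, on an algebra `O` of `K`-valued functions on `X`. -/
def evalAt {K : Type u} [Field K] {X : Type v} (O : Subalgebra K (X → K)) (x : X) :
    O →ₐ[K] K :=
  (Pi.evalAlgHom K (fun _ : X => K) x).comp O.val

/-- A set `X` together with an algebra `O` of `K`-valued functions (its regular functions) is an
affine variety (possibly reducible) if `O` is finitely generated and the points of `X` correspond
bijectively, through evaluation, to the `K`-algebra homomorphisms `O → K`. Over an algebraically
closed field these are, up to isomorphism, the Zariski closed subsets of affine spaces `K ^ n` with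
the restrictions of polynomials as regular functions. -/
structure IsAffineVariety {K : Type u} [Field K] {X : Type v}
    (O : Subalgebra K (X → K)) : Prop where
  fg : O.FG
  bijective_evalAt : Function.Bijective (evalAt O)

/-- Morphisms of varieties: maps that pull regular functions back to regular functions. -/
def IsMorphism {K : Type u} [Field K] {X : Type v} {Y : Type w}
    (OX : Subalgebra K (X → K)) (OY : Subalgebra K (Y → K)) (φ : X → Y) : Prop :=
  ∀ f ∈ OY, f ∘ φ ∈ OX

/-- The regular functions on the product of two affine varieties (`K[X × Y] = K[X] ⊗ K[Y]`): the
algebra generated by the functions pulled back from the two factors. -/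
def prodRegular {K : Type u} [Field K] {X : Type v} {Y : Type w}
    (OX : Subalgebra K (X → K)) (OY : Subalgebra K (Y → K)) : Subalgebra K (X × Y → K) :=
  Algebra.adjoin K
    ({h | ∃ f ∈ OX, h = fun p => f p.1} ∪ {h | ∃ g ∈ OY, h = fun p => g p.2})

/-- A monoid `M` with an algebra `O` of regular functions is an affine algebraic monoid if it is an
affine variety and its multiplication is a morphism `M × M → M`. -/
structure IsAffineAlgebraicMonoid {K : Type u} [Field K] {M : Type v} [Monoid M]
    (O : Subalgebra K (M → K)) : Prop where
  isAffineVariety : IsAffineVariety O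
  mul_isMorphism : IsMorphism (prodRegular O O) O (fun p : M × M => p.1 * p.2)

/-- The regular functions on the disjoint union `M ⊔ {𝔷}` of a variety `M` and a point `𝔷`
(here the adjoined `0` of `WithZero M`): the functions whose restriction to `M` is regular. -/
def withZeroRegular {K : Type u} [Field K] {M : Type v} (O : Subalgebra K (M → K)) :
    Subalgebra K (WithZero M → K) where
  carrier := {f | (fun m : M => f (m : WithZero M)) ∈ O}
  mul_mem' := fun hf hg => O.mul_mem hf hg
  add_mem' := fun hf hg => O.add_mem hf hg
  algebraMap_mem' := fun r => O.algebraMap_mem r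

/-- The monoid `End(A)` of all endomorphisms of a (not necessarily associative or unital)
algebra `A`, as a submonoid of the monoid `L(A)` of linear operators under composition. -/
def algEnd (K : Type u) [Field K] (A : Type v) [NonUnitalNonAssocRing A] [Module K A] :
    Submonoid (Module.End K A) where
  carrier := {σ | ∀ a b : A, σ (a * b) = σ a * σ b}
  one_mem' := fun _ _ => rfl
  mul_mem' := by
    intro σ τ hσ hτ a b
    simp only [Module.End.mul_apply]
    rw [hτ, hσ]

/-- The zero endomorphism. -/
def zeroEnd (K : Type u) [Field K] (A : Type v) [NonUnitalNonAssocRing A] [Module K A] :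
    algEnd K A :=
  ⟨0, fun a b => by simp⟩

/-- The regular functions on `End(A)`, for a finite-dimensional `A`: the restrictions of the
polynomial functions on the vector space `L(A)`, that is, the algebra generated by the restrictions
of the linear functionals on `L(A)`. -/
def endRegular (K : Type u) [Field K] (A : Type v) [NonUnitalNonAssocRing A] [Module K A] :
    Subalgebra K (algEnd K A → K) :=
  Algebra.adjoin K
    (Set.range fun (l : Module.Dual K (Module.End K A)) (σ : algEnd K A) =>
      l (σ : Module.End K A))

/-- The Zariski topology on a variety with algebra of regular functions `O`; its basic open sets are
the sets where a given regular function does not vanish. -/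
@[reducible] def zariskiTopology {K : Type u} [Field K] {X : Type v} (O : Subalgebra K (X → K)) :
    TopologicalSpace X :=
  TopologicalSpace.generateFrom {s | ∃ f ∈ O, s = {x | f x ≠ 0}}

/-- `{x}` is an isolated component for the Zariski topology: it is open, it is an irreducible
component, and it is a connected component. -/
def IsIsolatedComponent {K : Type u} [Field K] {X : Type v} (O : Subalgebra K (X → K))
    (x : X) : Prop :=
  @IsOpen X (zariskiTopology O) {x} ∧
    {x} ∈ @irreducibleComponents X (zariskiTopology O) ∧
    @connectedComponent X (zariskiTopology O) x = {x}

end AffMon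

/-! The monoid is recovered from its right translations on a finite-dimensional space of regular
functions, and the structure respected by those translations is packed into one algebra.

Sections of a regular function on `M × M` span a finite-dimensional space, so every
finite-dimensional space of regular functions lies in a bi-invariant one
(`exists_fg_isBiinvariant_ge`). Take such a `C` containing 1 and generators, and let `V = C ^ d`,
where `d` bounds the degrees of finitely many generating relations. A functional on `V` that sends 1
to 1 and is multiplicative whenever a product stays in `V` respects these relations, so it extends
to a character of `O` and is evaluation at a point (`exists_forall_partialCharacter_eq_eval`).

Let `g` be an operator on `V` that fixes 1, is compatible with the product `V × V → V * V`, and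
commutes with left translations. Then `f ↦ (g f)(1)` is such a functional, say evaluation at `m`.
Moving an arbitrary point to 1 by a left translation gives `(g f)(x) = f(xm)`, so `g` is right
translation by `m` (`exists_eq_rightTranslation`).

It remains to find an algebra whose nonzero endomorphisms are exactly these operators. On `D = V`,
`E = V * V` and auxiliary vectors `e`, `u`, `t j`, left multiplication by the idempotent `e` is
diagonal and separates the summands by nonzero eigenvalues. The only idempotents are 0 and `e`. An
endomorphism killing `e` is zero; one fixing `e` preserves the eigenspaces and must fix `u` and
every `t j`. Products of these vectors encode the unit and the operators that `g` has to commute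
with (`RigidData.eq_zero_or_exists_eq_extend`).

The `e`-coefficient of `σ e` is thus a regular function equal to 0 at the zero endomorphism and to 1
elsewhere, which isolates that point. Regularity in both directions comes from `(R_m f)(x) = f(xm)`,
where `R_m` is right translation by `m`. -/

namespace AffMon

/-- Pulling back functions along a map, as an algebra homomorphism. -/
def pullback (K : Type u) [Field K] {X : Type v} {Y : Type w} (φ : X → Y) :
    (Y → K) →ₐ[K] (X → K) where
  toFun f := f ∘ φ
  map_one' := rfl
  map_mul' _ _ := rfl
  map_zero' := rfl
  map_add' _ _ := rfl
  commutes' _ := rfl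

@[simp] theorem pullback_apply {K : Type u} [Field K] {X : Type v} {Y : Type w} (φ : X → Y)
    (f : Y → K) (x : X) : pullback K φ f x = f (φ x) := rfl

/-! ### Sections of regular functions on a product -/

section Finiteness

variable {K : Type u} [Field K] {X : Type v} {Y : Type w}

theorem span_singleton_le_toSubmodule {O : Subalgebra K (X → K)} {f : X → K} (hf : f ∈ O) :
    Submodule.span K {f} ≤ Subalgebra.toSubmodule O := by
  simpa [Submodule.span_le] using hf

theorem mul_le_toSubmodule {O : Subalgebra K (X → K)} {V W : Submodule K (X → K)}
    (hV : V ≤ Subalgebra.toSubmodule O) (hW : W ≤ Subalgebra.toSubmodule O) :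
    V * W ≤ Subalgebra.toSubmodule O :=
  Submodule.mul_le.2 fun _ hf _ hg => O.mul_mem (hV hf) (hW hg)

/-- A regular function on the product is a finite sum of products `f(x) g(y)`; its sections all lie
in the span of the `g`. -/
theorem exists_fg_forall_section_fst_mem {OX : Subalgebra K (X → K)} {OY : Subalgebra K (Y → K)}
    {h : X × Y → K} (hh : h ∈ prodRegular OX OY) :
    ∃ W : Submodule K (Y → K), W.FG ∧ W ≤ Subalgebra.toSubmodule OY ∧
      ∀ x, (fun y => h (x, y)) ∈ W := by
  induction hh using Algebra.adjoin_induction with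
  | mem h hh =>
    rcases hh with ⟨f, hf, rfl⟩ | ⟨g, hg, rfl⟩
    · refine ⟨_, Submodule.fg_span_singleton 1, span_singleton_le_toSubmodule OY.one_mem,
        fun x => Submodule.mem_span_singleton.2 ⟨f x, ?_⟩⟩
      ext; simp
    · exact ⟨_, Submodule.fg_span_singleton g, span_singleton_le_toSubmodule hg,
        fun x => Submodule.mem_span_singleton_self g⟩
  | algebraMap r =>
    refine ⟨_, Submodule.fg_span_singleton 1, span_singleton_le_toSubmodule OY.one_mem,
      fun x => Submodule.mem_span_singleton.2 ⟨r, ?_⟩⟩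
    ext; simp
  | add f g _ _ hf hg =>
    obtain ⟨V, hV, hVO, hfV⟩ := hf
    obtain ⟨W, hW, hWO, hgW⟩ := hg
    exact ⟨V ⊔ W, hV.sup hW, sup_le hVO hWO, fun x =>
      (V ⊔ W).add_mem (Submodule.mem_sup_left (hfV x)) (Submodule.mem_sup_right (hgW x))⟩
  | mul f g _ _ hf hg =>
    obtain ⟨V, hV, hVO, hfV⟩ := hf
    obtain ⟨W, hW, hWO, hgW⟩ := hg
    exact ⟨V * W, hV.mul hW, mul_le_toSubmodule hVO hWO, fun x =>
      Submodule.mul_mem_mul (hfV x) (hgW x)⟩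

theorem swap_mem_prodRegular {OX : Subalgebra K (X → K)} {OY : Subalgebra K (Y → K)}
    {h : X × Y → K} (hh : h ∈ prodRegular OX OY) : h ∘ Prod.swap ∈ prodRegular OY OX := by
  have : prodRegular OX OY ≤ (prodRegular OY OX).comap (pullback K Prod.swap) := by
    refine Algebra.adjoin_le ?_
    rintro _ (⟨f, hf, rfl⟩ | ⟨g, hg, rfl⟩)
    · exact Algebra.subset_adjoin (Or.inr ⟨f, hf, rfl⟩)
    · exact Algebra.subset_adjoin (Or.inl ⟨g, hg, rfl⟩)
  exact this hh

theorem exists_fg_forall_forall_mem {ι : Type*} {O : Subalgebra K (X → K)}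
    (T : ι → (X → K) →ₗ[K] (X → K))
    (hT : ∀ f ∈ O, ∃ W : Submodule K (X → K), W.FG ∧ W ≤ Subalgebra.toSubmodule O ∧
      ∀ i, T i f ∈ W)
    {V : Submodule K (X → K)} (hV : V.FG) (hVO : V ≤ Subalgebra.toSubmodule O) :
    ∃ W : Submodule K (X → K), W.FG ∧ W ≤ Subalgebra.toSubmodule O ∧
      ∀ f ∈ V, ∀ i, T i f ∈ W := by
  induction V, hV using Submodule.fg_induction with
  | singleton f =>
    obtain ⟨W, hW, hWO, h⟩ := hT f (hVO (Submodule.mem_span_singleton_self f))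
    refine ⟨W, hW, hWO, fun g hg i => ?_⟩
    obtain ⟨c, rfl⟩ := Submodule.mem_span_singleton.1 hg
    rw [map_smul]
    exact W.smul_mem c (h i)
  | sup V₁ V₂ _ _ h₁ h₂ =>
    obtain ⟨W₁, hW₁, hWO₁, h₁⟩ := h₁ (le_sup_left.trans hVO)
    obtain ⟨W₂, hW₂, hWO₂, h₂⟩ := h₂ (le_sup_right.trans hVO)
    refine ⟨W₁ ⊔ W₂, hW₁.sup hW₂, sup_le hWO₁ hWO₂, fun g hg i => ?_⟩
    obtain ⟨g₁, hg₁, g₂, hg₂, rfl⟩ := Submodule.mem_sup.1 hg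
    rw [map_add]
    exact (W₁ ⊔ W₂).add_mem (Submodule.mem_sup_left (h₁ _ hg₁ i))
      (Submodule.mem_sup_right (h₂ _ hg₂ i))

end Finiteness

/-! ### Local finiteness of translations and bi-invariant spaces -/

section Translations

variable {K : Type u} [Field K] {M : Type v} [Monoid M] {O : Subalgebra K (M → K)}

theorem exists_fg_forall_leftTranslate_mem
    (hO : IsMorphism (prodRegular O O) O (fun p : M × M => p.1 * p.2)) {f : M → K} (hf : f ∈ O) :
    ∃ W : Submodule K (M → K), W.FG ∧ W ≤ Subalgebra.toSubmodule O ∧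
      ∀ x, pullback K (fun y => x * y) f ∈ W :=
  exists_fg_forall_section_fst_mem (hO f hf)

theorem exists_fg_forall_rightTranslate_mem
    (hO : IsMorphism (prodRegular O O) O (fun p : M × M => p.1 * p.2)) {f : M → K} (hf : f ∈ O) :
    ∃ W : Submodule K (M → K), W.FG ∧ W ≤ Subalgebra.toSubmodule O ∧
      ∀ x, pullback K (fun y => y * x) f ∈ W :=
  exists_fg_forall_section_fst_mem (swap_mem_prodRegular (hO f hf))

/-- A space of functions on a monoid is bi-invariant if it is stable under left and right
translations. -/
def IsBiinvariant (V : Submodule K (M → K)) : Prop :=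
  ∀ x : M, V.map (pullback K (fun y => x * y)).toLinearMap ≤ V ∧
    V.map (pullback K (fun y => y * x)).toLinearMap ≤ V

theorem IsBiinvariant.left {V : Submodule K (M → K)} (hV : IsBiinvariant V) (x : M) {f : M → K}
    (hf : f ∈ V) : pullback K (fun y => x * y) f ∈ V :=
  (hV x).1 ⟨f, hf, rfl⟩

theorem IsBiinvariant.right {V : Submodule K (M → K)} (hV : IsBiinvariant V) (x : M) {f : M → K}
    (hf : f ∈ V) : pullback K (fun y => y * x) f ∈ V :=
  (hV x).2 ⟨f, hf, rfl⟩

theorem IsBiinvariant.pow {V : Submodule K (M → K)} (hV : IsBiinvariant V) (d : ℕ) :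
    IsBiinvariant (V ^ d) := by
  intro x
  rw [Submodule.map_pow, Submodule.map_pow]
  exact ⟨pow_le_pow_left' (hV x).1 d, pow_le_pow_left' (hV x).2 d⟩

theorem IsBiinvariant.mul {V W : Submodule K (M → K)} (hV : IsBiinvariant V)
    (hW : IsBiinvariant W) : IsBiinvariant (V * W) := by
  intro x
  rw [Submodule.map_mul, Submodule.map_mul]
  exact ⟨mul_le_mul' (hV x).1 (hW x).1, mul_le_mul' (hV x).2 (hW x).2⟩

/-- Every finite-dimensional space of regular functions lies in a bi-invariant one. -/
theorem exists_fg_isBiinvariant_ge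
    (hO : IsMorphism (prodRegular O O) O (fun p : M × M => p.1 * p.2))
    {V : Submodule K (M → K)} (hV : V.FG) (hVO : V ≤ Subalgebra.toSubmodule O) :
    ∃ C : Submodule K (M → K), C.FG ∧ C ≤ Subalgebra.toSubmodule O ∧ IsBiinvariant C ∧ V ≤ C := by
  -- All right translates of `V` lie in `W₁`, and all left translates of `W₁` in `W`, so the span
  -- `C` of the two-sided translates is finite-dimensional.
  obtain ⟨W₁, hW₁, hWO₁, h₁⟩ := exists_fg_forall_forall_mem
    (fun x : M => (pullback K (fun y => y * x)).toLinearMap)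
    (fun f hf => exists_fg_forall_rightTranslate_mem hO hf) hV hVO
  obtain ⟨W, hW, hWO, h⟩ := exists_fg_forall_forall_mem
    (fun x : M => (pullback K (fun y => x * y)).toLinearMap)
    (fun f hf => exists_fg_forall_leftTranslate_mem hO hf) hW₁ hWO₁
  let C : Submodule K (M → K) := Submodule.span K
    {g | ∃ f ∈ V, ∃ a b : M, g = pullback K (fun y => a * y * b) f}
  have hCW : C ≤ W := by
    refine Submodule.span_le.2 ?_
    rintro _ ⟨f, hf, a, b, rfl⟩
    exact h _ (h₁ f hf b) a
  have : FiniteDimensional K W := Module.Finite.of_fg hW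
  refine ⟨C, ?_, hCW.trans hWO, fun x => ⟨?_, ?_⟩, fun f hf => Submodule.subset_span ?_⟩
  · exact Module.Finite.iff_fg.1 (Submodule.finiteDimensional_of_le hCW)
  · rw [Submodule.map_span_le]
    rintro _ ⟨f, hf, a, b, rfl⟩
    refine Submodule.subset_span ⟨f, hf, a * x, b, ?_⟩
    ext y; simp [mul_assoc]
  · rw [Submodule.map_span_le]
    rintro _ ⟨f, hf, a, b, rfl⟩
    refine Submodule.subset_span ⟨f, hf, a, x * b, ?_⟩
    ext y; simp [mul_assoc]
  · exact ⟨f, hf, 1, 1, by ext y; simp⟩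

end Translations

/-! ### Partial characters are evaluations -/

section Characters

variable {K : Type u} [Field K] {X : Type v} {O : Subalgebra K (X → K)}

/-- Partial characters on a sufficiently high power of a generating subspace are evaluations at
points. -/
theorem exists_forall_partialCharacter_eq_eval (hO : Function.Surjective (evalAt O))
    {C : Submodule K (X → K)} (hC : C.FG) (h1 : 1 ∈ C) (hgen : Algebra.adjoin K (C : Set (X → K)) = O) :
    ∃ d : ℕ, C ≤ C ^ d ∧ ∀ χ : (X → K) →ₗ[K] K, χ 1 = 1 →
      (∀ f ∈ C ^ d, ∀ g ∈ C ^ d, f * g ∈ C ^ d → χ (f * g) = χ f * χ g) →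
      ∃ m : X, ∀ f ∈ C ^ d, χ f = f m := by
  obtain ⟨S, rfl⟩ := hC
  have h1' : (1 : Submodule K (X → K)) ≤ Submodule.span K S := Submodule.one_le.2 h1
  have hmono : ∀ {i j : ℕ}, i ≤ j → Submodule.span K (S : Set (X → K)) ^ i ≤ Submodule.span K S ^ j :=
    fun hij => pow_le_pow_right₀ h1' hij
  let ev : MvPolynomial S K →ₐ[K] (X → K) := MvPolynomial.aeval (fun s : S => (s : X → K))
  have hrange : ev.range = O := by
    rw [← hgen, Algebra.adjoin_span, ← Algebra.adjoin_range_eq_range_aeval]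
    simp
  obtain ⟨R, hR⟩ : (RingHom.ker ev).FG := IsNoetherian.noetherian _
  -- By Hilbert's basis theorem finitely many relations `R` suffice, and `d` bounds their degrees.
  -- The added 1 ensures `1 ≤ d`, hence `C ≤ C ^ d`.
  let d := R.sup MvPolynomial.totalDegree + 1
  refine ⟨d, ?_, fun χ hχ1 hχ => ?_⟩
  · simpa using hmono (show 1 ≤ d by omega)
  have hS : ∀ s : S, (s : X → K) ∈ Submodule.span K (S : Set (X → K)) :=
    fun s => Submodule.subset_span s.2
  let ψ : MvPolynomial S K →ₐ[K] K := MvPolynomial.aeval (fun s : S => χ s)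
  -- Variables are peeled off one at a time: every partial product has degree at most `d`, so it
  -- stays in `C ^ d` and the partial multiplicativity of `χ` applies.
  have hmon : ∀ (k : ℕ) (a : S →₀ ℕ), a.degree = k → k ≤ d →
      ev (MvPolynomial.monomial a 1) ∈ Submodule.span K (S : Set (X → K)) ^ k ∧
      χ (ev (MvPolynomial.monomial a 1)) = ψ (MvPolynomial.monomial a 1) := by
    intro k
    induction k with
    | zero =>
      intro a ha _
      rw [Finsupp.degree_eq_zero_iff] at ha
      subst ha
      have : (MvPolynomial.monomial (0 : S →₀ ℕ)) (1 : K) = 1 := rfl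
      rw [this, map_one ev, map_one ψ, hχ1]
      simp [Submodule.one_le.1 le_rfl]
    | succ k ih =>
      intro a ha hk
      obtain ⟨s, hs⟩ : ∃ s, a s ≠ 0 := by
        by_contra! h
        have : a = 0 := Finsupp.ext h
        simp [this] at ha
      obtain ⟨b, rfl⟩ : ∃ b : S →₀ ℕ, a = b + Finsupp.single s 1 := by
        refine ⟨a - Finsupp.single s 1, (tsub_add_cancel_of_le ?_).symm⟩
        rw [Finsupp.single_le_iff]; omega
      have hb : b.degree = k := by
        rw [map_add, Finsupp.degree_single] at ha; omega
      obtain ⟨hb1, hb2⟩ := ih b hb (by omega)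
      have hmul : (MvPolynomial.monomial (b + Finsupp.single s 1)) (1 : K) =
          MvPolynomial.monomial b 1 * MvPolynomial.X s := by
        rw [MvPolynomial.X, MvPolynomial.monomial_mul, one_mul]
      have hevX : ev (MvPolynomial.X s) = s := MvPolynomial.aeval_X _ _
      have hψX : ψ (MvPolynomial.X s) = χ s := MvPolynomial.aeval_X _ _
      have hm : ev (MvPolynomial.monomial b 1) * (s : X → K) ∈
          Submodule.span K (S : Set (X → K)) ^ (k + 1) := by
        rw [pow_succ]
        exact Submodule.mul_mem_mul hb1 (hS s)
      rw [hmul, map_mul ev, map_mul ψ, hevX, hψX, ← hb2]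
      refine ⟨hm, hχ _ (hmono (by omega) hb1) _ ?_ (hmono hk hm)⟩
      exact hmono (show 1 ≤ d by omega) (by simpa using hS s)
  have hpoly : ∀ p : MvPolynomial S K, p.totalDegree ≤ d → χ (ev p) = ψ p := by
    intro p hp
    conv_lhs => rw [p.as_sum]
    conv_rhs => rw [p.as_sum]
    simp only [map_sum]
    refine Finset.sum_congr rfl fun a ha => ?_
    have hsm : MvPolynomial.monomial a (p.coeff a) =
        p.coeff a • MvPolynomial.monomial a (1 : K) := by
      rw [MvPolynomial.smul_monomial, smul_eq_mul, mul_one]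
    rw [hsm, map_smul, map_smul, map_smul, (hmon _ a rfl ?_).2]
    exact (MvPolynomial.le_totalDegree ha).trans hp
  -- It suffices to check the generators `R`; their degrees are at most `d`, where `ψ` agrees with
  -- `χ ∘ ev`. Hence `ψ` descends to a genuine character of `O`.
  have hker : ∀ p, ev p = 0 → ψ p = 0 := by
    have : RingHom.ker ev ≤ RingHom.ker ψ := by
      rw [← hR]
      refine Ideal.span_le.2 fun p hp => ?_
      have hp0 : ev p = 0 := by
        have : p ∈ RingHom.ker ev := hR ▸ Ideal.subset_span hp
        exact this
      have : p.totalDegree ≤ d := (Finset.le_sup hp).trans (Nat.le_succ _)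
      change ψ p = 0
      rw [← hpoly p this, hp0, map_zero]
    exact fun p hp => this hp
  subst hrange
  let θ : ev.range →ₐ[K] K := (Ideal.Quotient.liftₐ (RingHom.ker ev) ψ hker).comp
    (Ideal.quotientKerEquivRange ev).symm.toAlgHom
  have hθ : ∀ p, θ ⟨ev p, p, rfl⟩ = ψ p := by
    intro p
    have : (Ideal.quotientKerEquivRange ev).symm ⟨ev p, p, rfl⟩ =
        Ideal.Quotient.mk (RingHom.ker ev) p := by
      rw [AlgEquiv.symm_apply_eq]; rfl
    change Ideal.Quotient.liftₐ (RingHom.ker ev) ψ hker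
      ((Ideal.quotientKerEquivRange ev).symm ⟨ev p, p, rfl⟩) = _
    rw [this]; rfl
  obtain ⟨m, hm⟩ := hO θ
  refine ⟨m, fun f hf => ?_⟩
  have hrep : ∀ (k : ℕ), ∀ f ∈ Submodule.span K (S : Set (X → K)) ^ k,
      ∃ p : MvPolynomial S K, p.totalDegree ≤ k ∧ ev p = f := by
    have hlin : ∀ f ∈ Submodule.span K (S : Set (X → K)),
        ∃ p : MvPolynomial S K, p.totalDegree ≤ 1 ∧ ev p = f := by
      intro f hf
      induction hf using Submodule.span_induction with
      | mem f hf =>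
        exact ⟨MvPolynomial.X ⟨f, hf⟩, (MvPolynomial.totalDegree_X _).le, MvPolynomial.aeval_X _ _⟩
      | zero => exact ⟨0, by simp, by simp⟩
      | add f g _ _ hf hg =>
        obtain ⟨p, hp, rfl⟩ := hf
        obtain ⟨q, hq, rfl⟩ := hg
        exact ⟨p + q, (MvPolynomial.totalDegree_add p q).trans (max_le hp hq), map_add _ _ _⟩
      | smul c f _ hf =>
        obtain ⟨p, hp, rfl⟩ := hf
        exact ⟨c • p, (MvPolynomial.totalDegree_smul_le c p).trans hp, map_smul _ _ _⟩
    intro k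
    induction k with
    | zero =>
      intro f hf
      obtain ⟨c, rfl⟩ := Submodule.mem_one.1 (by simpa using hf)
      exact ⟨MvPolynomial.C c, by simp, MvPolynomial.aeval_C _ _⟩
    | succ k ih =>
      intro f hf
      rw [pow_succ] at hf
      refine Submodule.mul_induction_on hf (fun f hf g hg => ?_) (fun f g hf hg => ?_)
      · obtain ⟨p, hp, rfl⟩ := ih f hf
        obtain ⟨q, hq, rfl⟩ := hlin g hg
        exact ⟨p * q, (MvPolynomial.totalDegree_mul p q).trans (add_le_add hp hq), map_mul _ _ _⟩
      · obtain ⟨p, hp, rfl⟩ := hf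
        obtain ⟨q, hq, rfl⟩ := hg
        exact ⟨p + q, (MvPolynomial.totalDegree_add p q).trans (max_le hp hq), map_add _ _ _⟩
  obtain ⟨p, hp, rfl⟩ := hrep d f hf
  rw [hpoly p hp, ← hθ p, ← hm]
  rfl

end Characters

end AffMon

/-! ### The rigidified algebra -/

namespace AffMon

/-- The input of the construction of a rigidified algebra: a bilinear map `D × D → E`, a vector of
`D`, and finitely many linear maps `D → E`. -/
structure RigidData (K : Type u) [Field K] (k : ℕ) (D E : Type u) [AddCommGroup D] [Module K D]
    [AddCommGroup E] [Module K E] where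
  /-- the bilinear map -/
  mul : D →ₗ[K] D →ₗ[K] E
  /-- the distinguished vector -/
  unit : D
  /-- the linear maps -/
  act : Fin k → D →ₗ[K] E
  /-- the eigenvalues of the left multiplication by the idempotent -/
  ev : ℕ → K
  ev_injective : Function.Injective ev
  ev_ne_zero : ∀ i, ev i ≠ 0
  ev_ne_one : ∀ i, ev i ≠ 1

variable {K : Type u} [Field K] {k : ℕ} {D E : Type u} [AddCommGroup D] [Module K D]
  [AddCommGroup E] [Module K E]

/-- The underlying space of the algebra of a `RigidData`. It has a basis vector `e` (an idempotent),
a basis vector `u`, basis vectors `t j`, and summands `D` and `E`. -/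
@[ext] structure RigidData.Alg (S : RigidData K k D E) : Type u where
  /-- the coefficient of the idempotent `e` -/
  e : K
  /-- the coefficient of `u` -/
  u : K
  /-- the coefficients of the vectors `t j` -/
  t : Fin k → K
  /-- the component in `D` -/
  d : D
  /-- the component in `E` -/
  h : E

namespace RigidData

variable (S : RigidData K k D E)

/-- The algebra as a product. -/
def equivProd : S.Alg ≃ K × K × (Fin k → K) × D × E where
  toFun a := (a.e, a.u, a.t, a.d, a.h)
  invFun a := ⟨a.1, a.2.1, a.2.2.1, a.2.2.2.1, a.2.2.2.2⟩
  left_inv _ := rfl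
  right_inv _ := rfl

instance : AddCommGroup S.Alg := S.equivProd.addCommGroup

instance : Module K S.Alg := S.equivProd.module K

variable {S}

@[simp] theorem zero_e : (0 : S.Alg).e = 0 := rfl
@[simp] theorem zero_u : (0 : S.Alg).u = 0 := rfl
@[simp] theorem zero_t : (0 : S.Alg).t = 0 := rfl
@[simp] theorem zero_d : (0 : S.Alg).d = 0 := rfl
@[simp] theorem zero_h : (0 : S.Alg).h = 0 := rfl
@[simp] theorem add_e (a b : S.Alg) : (a + b).e = a.e + b.e := rfl
@[simp] theorem add_u (a b : S.Alg) : (a + b).u = a.u + b.u := rfl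
@[simp] theorem add_t (a b : S.Alg) : (a + b).t = a.t + b.t := rfl
@[simp] theorem add_d (a b : S.Alg) : (a + b).d = a.d + b.d := rfl
@[simp] theorem add_h (a b : S.Alg) : (a + b).h = a.h + b.h := rfl
@[simp] theorem smul_e (c : K) (a : S.Alg) : (c • a).e = c * a.e := rfl
@[simp] theorem smul_u (c : K) (a : S.Alg) : (c • a).u = c * a.u := rfl
@[simp] theorem smul_t (c : K) (a : S.Alg) : (c • a).t = c • a.t := rfl
@[simp] theorem smul_d (c : K) (a : S.Alg) : (c • a).d = c • a.d := rfl
@[simp] theorem smul_h (c : K) (a : S.Alg) : (c • a).h = c • a.h := rfl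

/-- The nonzero products are as follows. Left multiplication by `e` has eigenvalue 1 on `e` and `u`,
`ev 0` on `D`, `ev 1` on `E`, and `ev (j + 2)` on `t j`. The products `u e = e`, `u u = unit` and `u
(t j) = e` pin down `u`, the unit and `t j`. Finally `t j` acts on `D` by `act j`, and `D`
multiplies into `E` by `mul`. -/
instance : Mul S.Alg where
  mul a b :=
    { e := a.e * b.e + a.u * b.e + a.u * ∑ j, b.t j
      u := a.e * b.u
      t := fun j => a.e * (S.ev (j + 2) * b.t j)
      d := a.e • S.ev 0 • b.d + (a.u * b.u) • S.unit
      h := a.e • S.ev 1 • b.h + ∑ j, a.t j • S.act j b.d + S.mul a.d b.d }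

theorem mul_e (a b : S.Alg) : (a * b).e = a.e * b.e + a.u * b.e + a.u * ∑ j, b.t j := rfl
theorem mul_u (a b : S.Alg) : (a * b).u = a.e * b.u := rfl
theorem mul_t (a b : S.Alg) (j : Fin k) : (a * b).t j = a.e * (S.ev (j + 2) * b.t j) := rfl
theorem mul_d (a b : S.Alg) : (a * b).d = a.e • S.ev 0 • b.d + (a.u * b.u) • S.unit := rfl
theorem mul_h (a b : S.Alg) :
    (a * b).h = a.e • S.ev 1 • b.h + ∑ j, a.t j • S.act j b.d + S.mul a.d b.d := rfl

instance : NonUnitalNonAssocRing S.Alg where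
  left_distrib a b c := by
    ext
    · simp only [mul_e, add_e, add_t, Pi.add_apply, Finset.sum_add_distrib]; ring
    · simp only [mul_u, add_u]; ring
    · simp only [mul_t, add_t, Pi.add_apply]; ring
    · simp only [mul_d, add_d, add_u]; module
    · simp only [mul_h, add_h, add_d, map_add, smul_add, Finset.sum_add_distrib]; abel
  right_distrib a b c := by
    ext
    · simp only [mul_e, add_e, add_u]; ring
    · simp only [mul_u, add_u, add_e]; ring
    · simp only [mul_t, add_t, Pi.add_apply, add_e]; ring
    · simp only [mul_d, add_d, add_u, add_e]; module
    · simp only [mul_h, add_h, add_d, add_e, add_t, Pi.add_apply, map_add, add_smul,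
        LinearMap.add_apply, Finset.sum_add_distrib]; abel
  zero_mul a := by
    ext <;> simp [mul_e, mul_u, mul_t, mul_d, mul_h]
  mul_zero a := by
    ext <;> simp [mul_e, mul_u, mul_t, mul_d, mul_h]

instance : IsScalarTower K S.Alg S.Alg where
  smul_assoc c a b := by
    simp only [smul_eq_mul]
    ext
    · simp only [mul_e, smul_e, smul_u]; ring
    · simp only [mul_u, smul_u, smul_e]; ring
    · simp only [mul_t, smul_t, smul_e, Pi.smul_apply, smul_eq_mul]; ring
    · simp only [mul_d, smul_d, smul_u, smul_e]; module
    · simp only [mul_h, smul_h, smul_d, smul_t, smul_e, Pi.smul_apply, smul_eq_mul, map_smul,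
        LinearMap.smul_apply, smul_add, Finset.smul_sum, mul_smul]

instance : SMulCommClass K S.Alg S.Alg where
  smul_comm c a b := by
    simp only [smul_eq_mul]
    ext
    · simp only [mul_e, smul_e, smul_t, Pi.smul_apply, smul_eq_mul, ← Finset.mul_sum]; ring
    · simp only [mul_u, smul_u]; ring
    · simp only [mul_t, smul_t, Pi.smul_apply, smul_eq_mul]; ring
    · simp only [mul_d, smul_d, smul_u]; module
    · simp only [mul_h, smul_h, smul_d, map_smul, smul_add, Finset.smul_sum,
        smul_comm c]

variable (S) in
/-- The algebra as a product, linearly. -/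
def linearEquivProd : S.Alg ≃ₗ[K] K × K × (Fin k → K) × D × E :=
  { S.equivProd with
    map_add' := fun _ _ => rfl
    map_smul' := fun _ _ => rfl }

instance [FiniteDimensional K D] [FiniteDimensional K E] : FiniteDimensional K S.Alg :=
  S.linearEquivProd.symm.finiteDimensional

/-- A pair of linear endomorphisms of `D` and `E` is compatible with the structure. -/
structure IsCompatible (S : RigidData K k D E) (g : D →ₗ[K] D) (g' : E →ₗ[K] E) : Prop where
  map_mul : ∀ a b, g' (S.mul a b) = S.mul (g a) (g b)
  map_unit : g S.unit = S.unit
  map_act : ∀ j a, g' (S.act j a) = S.act j (g a)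

variable (S) in
/-- The linear operator on the algebra given by operators on `D` and on `E`. -/
def extend (g : D →ₗ[K] D) (g' : E →ₗ[K] E) : S.Alg →ₗ[K] S.Alg where
  toFun a := ⟨a.e, a.u, a.t, g a.d, g' a.h⟩
  map_add' a b := by ext <;> simp
  map_smul' c a := by ext <;> simp

theorem extend_apply (g : D →ₗ[K] D) (g' : E →ₗ[K] E) (a : S.Alg) :
    S.extend g g' a = ⟨a.e, a.u, a.t, g a.d, g' a.h⟩ := rfl

theorem IsCompatible.extend_mem_algEnd {g : D →ₗ[K] D} {g' : E →ₗ[K] E}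
    (hg : S.IsCompatible g g') : S.extend g g' ∈ algEnd K S.Alg := by
  intro a b
  ext <;> simp [extend_apply, mul_e, mul_u, mul_t, mul_d, mul_h, hg.map_mul, hg.map_unit,
    hg.map_act]

variable (S) in
/-- The idempotent. -/
def idem : S.Alg := ⟨1, 0, 0, 0, 0⟩

variable (S) in
/-- The inclusion of `D`. -/
def inD : D →ₗ[K] S.Alg where
  toFun a := ⟨0, 0, 0, a, 0⟩
  map_add' a b := by ext <;> simp
  map_smul' c a := by ext <;> simp

variable (S) in
/-- The inclusion of `E`. -/
def inE : E →ₗ[K] S.Alg where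
  toFun a := ⟨0, 0, 0, 0, a⟩
  map_add' a b := by ext <;> simp
  map_smul' c a := by ext <;> simp

variable (S) in
/-- The projection to `D`. -/
def prD : S.Alg →ₗ[K] D where
  toFun a := a.d
  map_add' _ _ := rfl
  map_smul' _ _ := rfl

variable (S) in
/-- The projection to `E`. -/
def prE : S.Alg →ₗ[K] E where
  toFun a := a.h
  map_add' _ _ := rfl
  map_smul' _ _ := rfl

variable (S) in
/-- The coefficient of the idempotent. -/
def coeffE : S.Alg →ₗ[K] K where
  toFun a := a.e
  map_add' _ _ := rfl
  map_smul' _ _ := rfl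

variable (S) in
/-- The basis vector `u`. -/
def vecU : S.Alg := ⟨0, 1, 0, 0, 0⟩

variable (S) in
/-- The basis vector `t j`. -/
def vecT (j : Fin k) : S.Alg := ⟨0, 0, Pi.single j 1, 0, 0⟩

theorem idem_mul_idem : S.idem * S.idem = S.idem := by
  ext <;> simp [mul_e, mul_u, mul_t, mul_d, mul_h, idem]

theorem idem_mul_vecU : S.idem * S.vecU = S.vecU := by
  ext <;> simp [mul_e, mul_u, mul_t, mul_d, mul_h, idem, vecU]

theorem vecU_mul_idem : S.vecU * S.idem = S.idem := by
  ext <;> simp [mul_e, mul_u, mul_t, mul_d, mul_h, idem, vecU]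

theorem vecU_mul_vecU : S.vecU * S.vecU = S.inD S.unit := by
  ext <;> simp [mul_e, mul_u, mul_t, mul_d, mul_h, vecU, inD]

theorem idem_mul_vecT (j : Fin k) : S.idem * S.vecT j = S.ev (j + 2) • S.vecT j := by
  ext i <;> simp [mul_e, mul_u, mul_t, mul_d, mul_h, idem, vecT]
  by_cases h : i = j
  · subst h; simp
  · simp [h]

theorem vecU_mul_vecT (j : Fin k) : S.vecU * S.vecT j = S.idem := by
  ext <;> simp [mul_e, mul_u, mul_t, mul_d, mul_h, idem, vecU, vecT]

theorem idem_mul_inD (a : D) : S.idem * S.inD a = S.ev 0 • S.inD a := by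
  ext <;> simp [mul_e, mul_u, mul_t, mul_d, mul_h, idem, inD]

theorem idem_mul_inE (a : E) : S.idem * S.inE a = S.ev 1 • S.inE a := by
  ext <;> simp [mul_e, mul_u, mul_t, mul_d, mul_h, idem, inE]

theorem vecT_mul_inD (j : Fin k) (a : D) : S.vecT j * S.inD a = S.inE (S.act j a) := by
  ext <;> simp [mul_e, mul_u, mul_t, mul_d, mul_h, vecT, inD, inE, Pi.single_apply]

theorem inD_mul_inD (a b : D) : S.inD a * S.inD b = S.inE (S.mul a b) := by
  ext <;> simp [mul_e, mul_u, mul_t, mul_d, mul_h, inD, inE]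

theorem eq_sum (a : S.Alg) :
    a = a.e • S.idem + a.u • S.vecU + ∑ j : Fin k, a.t j • S.vecT j + S.inD a.d + S.inE a.h := by
  have key : ∑ j : Fin k, a.t j • S.vecT j = (⟨0, 0, a.t, 0, 0⟩ : S.Alg) := by
    let L : (Fin k → K) →ₗ[K] S.Alg :=
      { toFun := fun t => ⟨0, 0, t, 0, 0⟩
        map_add' := fun a b => by ext <;> simp
        map_smul' := fun a b => by ext <;> simp }
    change ∑ j : Fin k, a.t j • L (Pi.single j 1) = L a.t
    simp only [← map_smul, ← map_sum]
    congr 1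
    ext i
    simp [Finset.sum_apply, Pi.single_apply]
  rw [key]
  ext <;> simp [idem, vecU, inD, inE]

/-! ### Idempotents and endomorphisms of the rigidified algebra -/

/-- The only idempotents of the algebra are `0` and `e`. -/
theorem eq_zero_or_eq_idem {a : S.Alg} (ha : a * a = a) : a = 0 ∨ a = S.idem := by
  have he := congrArg Alg.e ha
  have hu := congrArg Alg.u ha
  have ht : ∀ j : Fin k, a.e * (S.ev (j + 2) * a.t j) = a.t j := fun j => by
    rw [← mul_t, ha]
  have hd := congrArg Alg.d ha
  have hh := congrArg Alg.h ha
  rw [mul_e] at he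
  rw [mul_u] at hu
  rw [mul_d] at hd
  rw [mul_h] at hh
  have hu' : a.u = 0 ∨ a.e = 1 := by
    by_cases h : a.u = 0
    · exact Or.inl h
    · exact Or.inr (mul_right_cancel₀ h (by rw [hu, one_mul]))
  have h01 : a.e = 0 ∨ a.e = 1 := by
    rcases hu' with h | h
    · rw [h] at he
      have : a.e * (a.e - 1) = 0 := by linear_combination he
      rcases mul_eq_zero.1 this with h | h
      · exact Or.inl h
      · exact Or.inr (sub_eq_zero.1 h)
    · exact Or.inr h
  rcases h01 with h | h
  · left
    have u0 : a.u = 0 := by rw [← hu, h, zero_mul]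
    have d0 : a.d = 0 := by rw [← hd, h, u0]; simp
    have t0 : a.t = 0 := by ext j; rw [← ht j, h, zero_mul]; rfl
    have h0 : a.h = 0 := by rw [← hh, h, d0]; simp
    exact Alg.ext h u0 t0 d0 h0
  · right
    -- With `e`-coefficient 1, a nonzero `t j` coordinate would force an eigenvalue 1. Once `t = 0`,
    -- the `e`-coordinate reads `1 + u = 1`, which removes the `u u` term from the `D`-coordinate.
    have t0 : a.t = 0 := by
      ext j
      have := ht j
      rw [h, one_mul] at this
      by_contra h'
      exact S.ev_ne_one _ (mul_right_cancel₀ h' (by rw [this, one_mul]))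
    have u0 : a.u = 0 := by
      rw [h, t0] at he
      simpa using he
    have d0 : a.d = 0 := by
      rw [h, u0, one_smul, mul_zero, zero_smul, add_zero] at hd
      by_contra h'
      exact S.ev_ne_one 0 (smul_left_injective K h' (by simpa using hd))
    have h0 : a.h = 0 := by
      rw [h, d0] at hh
      simp only [one_smul, map_zero, smul_zero, Finset.sum_const_zero, add_zero] at hh
      by_contra h'
      exact S.ev_ne_one 1 (smul_left_injective K h' (by simpa using hh))
    exact Alg.ext h u0 t0 d0 h0

section Eigen

variable {a : S.Alg} {c : K}

theorem eigen_scalar {x y c : K} (h : x * y = c * y) (hxc : x ≠ c) : y = 0 := by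
  by_contra hy
  exact hxc (mul_right_cancel₀ hy h)

theorem eigen_vector {V : Type*} [AddCommGroup V] [Module K V] {x c : K} {y : V}
    (h : x • y = c • y) (hxc : x ≠ c) : y = 0 := by
  by_contra hy
  exact hxc (smul_left_injective K hy h)

theorem e_eq_zero_of_idem_mul (h : S.idem * a = c • a) (hc : c ≠ 1) : a.e = 0 := by
  have := congrArg Alg.e h
  simp only [mul_e, idem, smul_e, zero_mul, add_zero] at this
  exact eigen_scalar this hc.symm

theorem u_eq_zero_of_idem_mul (h : S.idem * a = c • a) (hc : c ≠ 1) : a.u = 0 := by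
  have := congrArg Alg.u h
  simp only [mul_u, idem, smul_u] at this
  exact eigen_scalar this hc.symm

theorem t_eq_zero_of_idem_mul (h : S.idem * a = c • a) {j : Fin k} (hc : S.ev (j + 2) ≠ c) :
    a.t j = 0 := by
  have := congrFun (congrArg Alg.t h) j
  simp only [mul_t, idem, smul_t, one_mul, Pi.smul_apply, smul_eq_mul] at this
  exact eigen_scalar this hc

theorem d_eq_zero_of_idem_mul (h : S.idem * a = c • a) (hc : S.ev 0 ≠ c) : a.d = 0 := by
  have := congrArg Alg.d h
  simp only [mul_d, idem, smul_d, one_smul, zero_mul, zero_smul, add_zero] at this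
  exact eigen_vector this hc

theorem h_eq_zero_of_idem_mul (h : S.idem * a = c • a) (hc : S.ev 1 ≠ c) : a.h = 0 := by
  have := congrArg Alg.h h
  simp only [mul_h, idem, smul_h, one_smul, map_zero, LinearMap.zero_apply, Pi.zero_apply,
    zero_smul, Finset.sum_const_zero, add_zero] at this
  exact eigen_vector this hc

end Eigen

/-- If `e b = c b` with `c ≠ 0`, then `c σ(b) = σ(e) σ(b) = 0`; such eigenvectors together with `e`
span the algebra. -/
theorem eq_zero_of_apply_idem_eq_zero {σ : Module.End K S.Alg} (hσ : σ ∈ algEnd K S.Alg)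
    (h : σ S.idem = 0) : σ = 0 := by
  have key : ∀ (c : K) (b : S.Alg), c ≠ 0 → S.idem * b = c • b → σ b = 0 := by
    intro c b hc hb
    have := hσ S.idem b
    rw [h, hb, zero_mul, map_smul] at this
    exact (smul_eq_zero.1 this).resolve_left hc
  ext1 a
  rw [eq_sum a]
  simp only [map_add, map_sum, map_smul, h, LinearMap.zero_apply,
    key 1 _ one_ne_zero (idem_mul_vecU.trans (one_smul _ _).symm),
    key _ _ (S.ev_ne_zero _) (idem_mul_vecT _), key _ _ (S.ev_ne_zero _) (idem_mul_inD _),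
    key _ _ (S.ev_ne_zero _) (idem_mul_inE _), smul_zero, Finset.sum_const_zero, add_zero]

/-- An endomorphism either is zero or comes from a compatible pair of operators. -/
theorem eq_zero_or_exists_eq_extend {σ : Module.End K S.Alg} (hσ : σ ∈ algEnd K S.Alg) :
    σ = 0 ∨ ∃ g g', S.IsCompatible g g' ∧ σ = S.extend g g' := by
  have hidem : σ S.idem * σ S.idem = σ S.idem := by rw [← hσ, idem_mul_idem]
  rcases eq_zero_or_eq_idem hidem with h | h
  · exact Or.inl (eq_zero_of_apply_idem_eq_zero hσ h)
  right
  -- Since `σ` fixes `e`, it preserves each eigenspace of left multiplication by `e`.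
  have heig : ∀ (c : K) (b : S.Alg), S.idem * b = c • b → S.idem * σ b = c • σ b := by
    intro c b hb
    have := hσ S.idem b
    rwa [h, hb, map_smul, eq_comm] at this
  have hinj : ∀ {i j : ℕ}, i ≠ j → S.ev i ≠ S.ev j := fun hij h => hij (S.ev_injective h)
  have hD : ∀ a, σ (S.inD a) = S.inD (S.prD (σ (S.inD a))) := by
    intro a
    have := heig _ _ (idem_mul_inD a)
    exact Alg.ext (e_eq_zero_of_idem_mul this (S.ev_ne_one _))
      (u_eq_zero_of_idem_mul this (S.ev_ne_one _))
      (funext fun j => t_eq_zero_of_idem_mul this (hinj (by omega))) rfl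
      (h_eq_zero_of_idem_mul this (hinj (by omega)))
  have hE : ∀ a, σ (S.inE a) = S.inE (S.prE (σ (S.inE a))) := by
    intro a
    have := heig _ _ (idem_mul_inE a)
    exact Alg.ext (e_eq_zero_of_idem_mul this (S.ev_ne_one _))
      (u_eq_zero_of_idem_mul this (S.ev_ne_one _))
      (funext fun j => t_eq_zero_of_idem_mul this (hinj (by omega)))
      (d_eq_zero_of_idem_mul this (hinj (by omega))) rfl
  have hinD : ∀ {a b}, S.inD a = S.inD b → a = b := fun h => congrArg Alg.d h
  have hinE : ∀ {a b}, S.inE a = S.inE b → a = b := fun h => congrArg Alg.h h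
  -- The eigenvalue 1 gives `σ u = α e + β u`. From `u e = e` comes `α + β = 1`. Since `u u` lies in
  -- `D`, the `e`-coefficient `α (α + β)` of `(σ u)²` vanishes, so `α = 0` and `β = 1`.
  have hU : σ S.vecU = S.vecU := by
    have h1 : S.idem * σ S.vecU = (1 : K) • σ S.vecU :=
      heig _ _ (idem_mul_vecU.trans (one_smul _ _).symm)
    have h2 : σ S.vecU * S.idem = S.idem := by rw [← h, ← hσ, vecU_mul_idem]
    have h3 := congrArg Alg.u h2
    have h4 := congrArg Alg.u (hσ S.vecU S.vecU)
    rw [vecU_mul_vecU, hD] at h4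
    have t0 : (σ S.vecU).t = 0 := funext fun j => t_eq_zero_of_idem_mul h1 (S.ev_ne_one _)
    have h5 := congrArg Alg.e h2
    have h6 := congrArg Alg.e (hσ S.vecU S.vecU)
    rw [vecU_mul_vecU, hD] at h6
    simp only [mul_e, mul_u, t0, inD, idem] at h3 h4 h5 h6
    simp at h3 h4 h5 h6
    have e0 : (σ S.vecU).e = 0 := by
      have : (σ S.vecU).e * ((σ S.vecU).e + (σ S.vecU).u) = 0 := by linear_combination -h6
      rw [h5, mul_one] at this
      exact this
    rw [e0, zero_add] at h5
    exact Alg.ext e0 h5 t0 (d_eq_zero_of_idem_mul h1 (S.ev_ne_one _))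
      (h_eq_zero_of_idem_mul h1 (S.ev_ne_one _))
  -- The eigenspace of `ev (j + 2)` is the line of `t j`, and `u (t j) = e` with `u`, `e` fixed
  -- makes the scalar 1.
  have hT : ∀ j, σ (S.vecT j) = S.vecT j := by
    intro j
    have h1 := heig _ _ (idem_mul_vecT j)
    have h2 := congrArg Alg.e (hσ S.vecU (S.vecT j))
    have h0 : ∀ i, i ≠ j → (σ (S.vecT j)).t i = 0 := fun i hi =>
      t_eq_zero_of_idem_mul h1 (hinj fun h => hi (Fin.ext (by omega)))
    have e0 : (σ (S.vecT j)).e = 0 := e_eq_zero_of_idem_mul h1 (S.ev_ne_one _)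
    rw [vecU_mul_vecT, h, hU, mul_e, e0,
      Finset.sum_eq_single j (fun i _ hi => h0 i hi) (by simp)] at h2
    simp only [idem, vecU, mul_zero, one_mul, zero_add] at h2
    refine Alg.ext e0 (u_eq_zero_of_idem_mul h1 (S.ev_ne_one _)) (funext fun i => ?_)
      (d_eq_zero_of_idem_mul h1 (hinj (by omega))) (h_eq_zero_of_idem_mul h1 (hinj (by omega)))
    change (σ (S.vecT j)).t i = (Pi.single j 1 : Fin k → K) i
    by_cases hi : i = j
    · subst hi
      rw [← h2, Pi.single_eq_same]
    · rw [h0 i hi, Pi.single_eq_of_ne hi]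
  refine ⟨S.prD ∘ₗ σ ∘ₗ S.inD, S.prE ∘ₗ σ ∘ₗ S.inE, ⟨fun a b => ?_, ?_, fun j a => ?_⟩, ?_⟩
  · apply hinE
    simp only [LinearMap.comp_apply]
    rw [← hE, ← inD_mul_inD, ← inD_mul_inD, hσ, ← hD, ← hD]
  · apply hinD
    simp only [LinearMap.comp_apply]
    rw [← hD, ← vecU_mul_vecU, hσ, hU]
  · apply hinE
    simp only [LinearMap.comp_apply]
    rw [← hE, ← vecT_mul_inD, ← vecT_mul_inD, hσ, ← hD, hT]
  · ext1 a
    conv_lhs => rw [eq_sum a]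
    conv_rhs => rw [extend_apply, eq_sum (Alg.mk _ _ _ _ _)]
    simp only [map_add, map_sum, map_smul, h, hU, hT, LinearMap.comp_apply]
    rw [← hD, ← hE]

theorem extend_injective {g₁ g₂ : D →ₗ[K] D} {g₁' g₂' : E →ₗ[K] E}
    (h : S.extend g₁ g₁' = S.extend g₂ g₂') : g₁ = g₂ :=
  LinearMap.ext fun a => congrArg Alg.d (LinearMap.congr_fun h (S.inD a))

end RigidData

end AffMon

/-! ### Windows and their right translations -/

namespace AffMon

variable {K : Type u} [Field K]

section Coordinates

variable {X : Type v} {V : Submodule K (X → K)} {D E : Type*} [AddCommGroup D] [Module K D]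
  [AddCommGroup E] [Module K E]

theorem ext_of_equiv (i : D ≃ₗ[K] V) {a b : D} (h : ∀ x, (i a : X → K) x = (i b : X → K) x) :
    a = b :=
  i.injective (Subtype.ext (funext h))

/-- The product of functions `V × V → V * V`, in coordinates. -/
def mulMap (i : D ≃ₗ[K] V) (i' : E ≃ₗ[K] ↥(V * V)) : D →ₗ[K] D →ₗ[K] E :=
  LinearMap.mk₂ K
    (fun a b => i'.symm ⟨(i a : X → K) * i b, Submodule.mul_mem_mul (i a).2 (i b).2⟩)
    (fun a b c => by rw [← map_add]; congr 1; ext; simp [add_mul])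
    (fun c a b => by rw [← map_smul]; congr 1; ext; simp [mul_assoc])
    (fun a b c => by rw [← map_add]; congr 1; ext; simp [mul_add])
    (fun c a b => by rw [← map_smul]; congr 1; ext; simp [mul_left_comm])

theorem mulMap_apply (i : D ≃ₗ[K] V) (i' : E ≃ₗ[K] ↥(V * V)) (a b : D) (x : X) :
    (i' (mulMap i i' a b) : X → K) x = (i a : X → K) x * (i b : X → K) x := by
  simp [mulMap]

end Coordinates

variable {M : Type v} [Monoid M]

/-- A finite-dimensional bi-invariant space of regular functions that generates all of them, and
whose partial characters are the evaluations at points. -/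
structure IsWindow (O : Subalgebra K (M → K)) (V : Submodule K (M → K)) : Prop where
  fg : V.FG
  one_mem : 1 ∈ V
  isBiinvariant : IsBiinvariant V
  adjoin_eq : Algebra.adjoin K (V : Set (M → K)) = O
  exists_eval : ∀ χ : (M → K) →ₗ[K] K, χ 1 = 1 →
    (∀ f ∈ V, ∀ g ∈ V, f * g ∈ V → χ (f * g) = χ f * χ g) → ∃ m : M, ∀ f ∈ V, χ f = f m

theorem exists_isWindow {O : Subalgebra K (M → K)} (hM : IsAffineAlgebraicMonoid O) :
    ∃ V, IsWindow O V := by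
  obtain ⟨S, hS⟩ := hM.isAffineVariety.fg
  have hSO : (S : Set (M → K)) ⊆ O := hS ▸ Algebra.subset_adjoin
  obtain ⟨C, hC, hCO, hCinv, hSC⟩ := exists_fg_isBiinvariant_ge hM.mul_isMorphism
    (V := Submodule.span K (S : Set (M → K)) ⊔ Submodule.span K {1})
    ((Submodule.fg_span S.finite_toSet).sup (Submodule.fg_span_singleton 1))
    (sup_le (Submodule.span_le.2 hSO) (span_singleton_le_toSubmodule O.one_mem))
  have h1C : 1 ∈ C := hSC (Submodule.mem_sup_right (Submodule.mem_span_singleton_self 1))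
  have hgen : Algebra.adjoin K (C : Set (M → K)) = O := by
    refine le_antisymm (Algebra.adjoin_le hCO) ?_
    rw [← hS]
    exact Algebra.adjoin_mono fun f hf =>
      hSC (Submodule.mem_sup_left (Submodule.subset_span hf))
  obtain ⟨d, hd, h⟩ := exists_forall_partialCharacter_eq_eval
    hM.isAffineVariety.bijective_evalAt.surjective hC h1C hgen
  refine ⟨C ^ d, hC.pow d, hd h1C, hCinv.pow d, le_antisymm (Algebra.adjoin_le ?_) ?_, h⟩
  · have hpow : ∀ n, C ^ n ≤ Subalgebra.toSubmodule O := fun n => by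
      induction n with
      | zero => rw [pow_zero, Submodule.one_le]; exact O.one_mem
      | succ n ih => rw [pow_succ]; exact mul_le_toSubmodule ih hCO
    exact hpow d
  · rw [← hgen]
    exact Algebra.adjoin_mono hd

theorem IsWindow.le_toSubmodule {O : Subalgebra K (M → K)} {V : Submodule K (M → K)}
    (hV : IsWindow O V) : V ≤ Subalgebra.toSubmodule O := fun _ hf =>
  hV.adjoin_eq ▸ Algebra.subset_adjoin hf

section RightTranslation

variable {V : Submodule K (M → K)} {D : Type w} [AddCommGroup D] [Module K D]

/-- The right translation by `m` on a bi-invariant space of functions `V`, seen on a space `D`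
isomorphic to it. -/
def rightTranslation (hV : IsBiinvariant V) (i : D ≃ₗ[K] V) (m : M) : D →ₗ[K] D :=
  i.symm.toLinearMap ∘ₗ
    ((pullback K (fun y => y * m)).toLinearMap.restrict fun _ hf => hV.right m hf) ∘ₗ i.toLinearMap

theorem rightTranslation_apply (hV : IsBiinvariant V) (i : D ≃ₗ[K] V) (m : M) (a : D) (x : M) :
    (i (rightTranslation hV i m a) : M → K) x = (i a : M → K) (x * m) := by
  simp only [rightTranslation, LinearMap.comp_apply, LinearEquiv.coe_coe,
    LinearEquiv.apply_symm_apply]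
  rfl

theorem rightTranslation_one (hV : IsBiinvariant V) (i : D ≃ₗ[K] V) :
    rightTranslation hV i 1 = LinearMap.id :=
  LinearMap.ext fun a => ext_of_equiv i fun x => by simp [rightTranslation_apply]

theorem rightTranslation_mul (hV : IsBiinvariant V) (i : D ≃ₗ[K] V) (m n : M) :
    rightTranslation hV i (m * n) = rightTranslation hV i m ∘ₗ rightTranslation hV i n :=
  LinearMap.ext fun a => ext_of_equiv i fun x => by simp [rightTranslation_apply, mul_assoc]

/-- The matrix coefficients of the right translations are regular. -/
theorem coeff_rightTranslation_mem [FiniteDimensional K D] {O : Subalgebra K (M → K)}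
    (hV : IsBiinvariant V) (hVO : V ≤ Subalgebra.toSubmodule O) (i : D ≃ₗ[K] V)
    (ξ : Module.Dual K D) (a : D) : (fun m => ξ (rightTranslation hV i m a)) ∈ O := by
  -- Evaluations at points span the dual of `V`, so `ξ` may be taken to be evaluation at `x`; then
  -- `m ↦ f(xm)` is a left translate of `f`.
  let ev : M → Module.Dual K D := fun x => LinearMap.proj x ∘ₗ V.subtype ∘ₗ i.toLinearMap
  have hspan : Submodule.span K (Set.range ev) = ⊤ := by
    refine Submodule.span_eq_top_of_ne_zero fun a ha => ?_
    by_contra! h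
    refine ha (ext_of_equiv i fun x => ?_)
    rw [map_zero]
    exact h (ev x) ⟨x, rfl⟩
  have hξ : ξ ∈ Submodule.span K (Set.range ev) := hspan ▸ Submodule.mem_top
  induction hξ using Submodule.span_induction with
  | mem ξ h =>
    obtain ⟨x, rfl⟩ := h
    have : (fun m => ev x (rightTranslation hV i m a)) = pullback K (fun y => x * y) (i a) :=
      funext fun m => rightTranslation_apply hV i m a x
    rw [this]
    exact hVO (hV.left x (i a).2)
  | zero => exact O.zero_mem
  | add ξ η _ _ h₁ h₂ => exact O.add_mem h₁ h₂
  | smul c ξ _ h => exact O.smul_mem h c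

end RightTranslation

/-! ### Operators compatible with a window -/

section Construction

variable {D E : Type u} [AddCommGroup D] [Module K D] [AddCommGroup E] [Module K E]
  {V : Submodule K (M → K)}

/-- The operators commuting with all right translations. -/
def commutant (hV : IsBiinvariant V) (i : D ≃ₗ[K] V) : Submodule K (Module.End K D) where
  carrier := {T | ∀ m a, T (rightTranslation hV i m a) = rightTranslation hV i m (T a)}
  add_mem' hS hT m a := by
    rw [LinearMap.add_apply, hS, hT, LinearMap.add_apply, map_add]
  zero_mem' m a := by simp
  smul_mem' c T hT m a := by
    rw [LinearMap.smul_apply, hT, LinearMap.smul_apply, map_smul]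

variable [FiniteDimensional K D]

/-- The structure on a window that is preserved by the right translations only. -/
noncomputable def windowData (hV : IsBiinvariant V) (h1 : 1 ∈ V) (i : D ≃ₗ[K] V)
    (i' : E ≃ₗ[K] ↥(V * V)) (ev : ℕ → K) (hev : Function.Injective ev) (h0 : ∀ n, ev n ≠ 0)
    (h1' : ∀ n, ev n ≠ 1) :
    RigidData K (Module.finrank K (commutant hV i)) D E where
  mul := mulMap i i'
  unit := i.symm ⟨1, h1⟩
  -- Multiplication by 1 embeds `V` in `V * V`, so compatibility with `act j` makes `g` commute with
  -- the basis operator `T_j`. The commutant contains all left translations, and a finite basis of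
  -- it needs only finitely many vectors `t j`.
  act j := mulMap i i' (i.symm ⟨1, h1⟩) ∘ₗ (Module.finBasis K (commutant hV i) j : Module.End K D)
  ev := ev
  ev_injective := hev
  ev_ne_zero := h0
  ev_ne_one := h1'

variable (hV : IsBiinvariant V) (h1 : 1 ∈ V) (i : D ≃ₗ[K] V) (i' : E ≃ₗ[K] ↥(V * V)) {ev : ℕ → K}
  (hev : Function.Injective ev) (h0 : ∀ n, ev n ≠ 0) (h1' : ∀ n, ev n ≠ 1)

theorem isCompatible_rightTranslation (m : M) :
    (windowData hV h1 i i' ev hev h0 h1').IsCompatible (rightTranslation hV i m)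
      (rightTranslation (hV.mul hV) i' m) where
  map_mul a b := ext_of_equiv i' fun x => by
    simp [windowData, rightTranslation_apply, mulMap_apply]
  map_unit := ext_of_equiv i fun x => by
    simp [windowData, rightTranslation_apply]
  map_act j a := ext_of_equiv i' fun x => by
    have := (Module.finBasis K (commutant hV i) j).2 m a
    simp [windowData, rightTranslation_apply, mulMap_apply, this]

/-- An operator commuting with left translations is determined by its values at 1, and these form a
partial character of the window, hence an evaluation. -/
theorem exists_eq_rightTranslation {O : Subalgebra K (M → K)} (hW : IsWindow O V)
    {g : D →ₗ[K] D} {g' : E →ₗ[K] E}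
    (hg : (windowData hV h1 i i' ev hev h0 h1').IsCompatible g g') :
    ∃ m : M, g = rightTranslation hV i m ∧ g' = rightTranslation (hV.mul hV) i' m := by
  have hmul : ∀ a b, g' (mulMap i i' a b) = mulMap i i' (g a) (g b) := hg.map_mul
  have hunit : g (i.symm ⟨1, h1⟩) = i.symm ⟨1, h1⟩ := hg.map_unit
  have hone : ∀ a x, (i' (mulMap i i' (i.symm ⟨1, h1⟩) a) : M → K) x = (i a : M → K) x := by
    intro a x
    simp [mulMap_apply]
  have hT : ∀ T ∈ commutant hV i, ∀ a, g (T a) = T (g a) := by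
    have hbasis : ∀ j a, g ((Module.finBasis K (commutant hV i) j : Module.End K D) a) =
        (Module.finBasis K (commutant hV i) j : Module.End K D) (g a) := by
      intro j a
      refine ext_of_equiv i fun x => ?_
      have h := hg.map_act j a
      change g' (mulMap i i' _ _) = mulMap i i' _ _ at h
      rw [hmul, hunit] at h
      rw [← hone, ← hone _ x, h]
    intro T hT a
    have hrepr := congrArg Subtype.val ((Module.finBasis K (commutant hV i)).sum_repr ⟨T, hT⟩)
    simp only [Submodule.coe_sum, Submodule.coe_smul] at hrepr
    rw [← hrepr]
    simp only [LinearMap.sum_apply, LinearMap.smul_apply, map_sum, map_smul, hbasis]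
  -- The functional `f ↦ (g f)(1)` lives on `V`; its extension to all functions is arbitrary.
  obtain ⟨χ, hχ⟩ := LinearMap.exists_extend
    ((LinearMap.proj (1 : M) : (M → K) →ₗ[K] K) ∘ₗ V.subtype ∘ₗ i.toLinearMap ∘ₗ g ∘ₗ
      i.symm.toLinearMap)
  have hχ' : ∀ a, χ (i a) = (i (g a) : M → K) 1 := by
    intro a
    have := LinearMap.congr_fun hχ (i a)
    simpa using this
  obtain ⟨m, hm⟩ := hW.exists_eval χ (by
      have := hχ' (i.symm ⟨1, h1⟩)
      rw [hunit] at this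
      simpa using this) (by
    intro f hf f' hf' hff'
    obtain ⟨a, ha⟩ := i.surjective ⟨f, hf⟩
    obtain ⟨b, hb⟩ := i.surjective ⟨f', hf'⟩
    obtain ⟨c, hc⟩ := i.surjective ⟨f * f', hff'⟩
    replace ha : (i a : M → K) = f := congrArg Subtype.val ha
    replace hb : (i b : M → K) = f' := congrArg Subtype.val hb
    replace hc : (i c : M → K) = f * f' := congrArg Subtype.val hc
    -- When `f f'` lies in `V`, it gives the same element of `V * V` as `1 · (f f')` and as `f ·
    -- f'`. Applying `g'` to both forms yields `g(f f') = g(f) g(f')`.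
    have habc : mulMap i i' (i.symm ⟨1, h1⟩) c = mulMap i i' a b :=
      ext_of_equiv i' fun x => by rw [hone, mulMap_apply, hc, ha, hb]; rfl
    rw [← hc, ← ha, ← hb, hχ', hχ', hχ', ← mulMap_apply i i', ← hmul, ← habc, hmul, hunit, hone])
  have hgm : g = rightTranslation hV i m := by
    refine LinearMap.ext fun a => ext_of_equiv i fun x => ?_
    -- For `L` the left translation by `x`: `(g f)(x) = (L g f)(1) = (g L f)(1) = (L f)(m) = f(xm)`.
    let L : Module.End K D := i.symm.toLinearMap ∘ₗ
      ((pullback K (fun y => x * y)).toLinearMap.restrict fun _ hf => hV.left x hf) ∘ₗ i.toLinearMap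
    have hL : ∀ b y, (i (L b) : M → K) y = (i b : M → K) (x * y) := fun b y => by
      simp only [L, LinearMap.comp_apply, LinearEquiv.coe_coe, LinearEquiv.apply_symm_apply]
      rfl
    have hLmem : L ∈ commutant hV i := fun n b => ext_of_equiv i fun y => by
      simp only [hL, rightTranslation_apply, mul_assoc]
    have := hL (g a) 1
    rw [← hT L hLmem, ← hχ', hm _ (i (L a)).2, hL, mul_one] at this
    rw [rightTranslation_apply, this]
  refine ⟨m, hgm, ?_⟩
  have hcompat := isCompatible_rightTranslation hV h1 i i' hev h0 h1' m
  -- Products span `V * V`, and on products `g'` is determined by `g`.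
  have key : V * V ≤ (LinearMap.eqLocus g' (rightTranslation (hV.mul hV) i' m)).map
      ((V * V).subtype ∘ₗ i'.toLinearMap) := by
    refine Submodule.mul_le.2 fun f hf f' hf' => ?_
    refine ⟨mulMap i i' (i.symm ⟨f, hf⟩) (i.symm ⟨f', hf'⟩), ?_, ?_⟩
    · rw [SetLike.mem_coe, LinearMap.mem_eqLocus, hmul, hgm]
      exact (hcompat.map_mul _ _).symm
    · ext x
      simp [mulMap_apply]
  refine LinearMap.ext fun c => ?_
  obtain ⟨c', hc', h⟩ := key (i' c).2
  have : c' = c := i'.injective (Subtype.ext h)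
  subst this
  exact hc'

end Construction

end AffMon

/-! ### Isolated points and morphisms into the endomorphism monoid -/

namespace AffMon

section IsolatedComponent

variable {K : Type u} [Field K] {X : Type v} {O : Subalgebra K (X → K)}

/-- The nonvanishing loci of `1 - f` and `f` are `{x}` and its complement, so `{x}` is clopen; an
irreducible set containing `x` is connected and cannot be larger. -/
theorem isIsolatedComponent_of_mem {x : X} {f : X → K} (hf : f ∈ O) (hx : f x = 0)
    (h : ∀ y ≠ x, f y = 1) : IsIsolatedComponent O x := by
  let _ := zariskiTopology O
  have hopen : IsOpen ({x} : Set X) := by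
    refine TopologicalSpace.isOpen_generateFrom_of_mem ⟨1 - f, O.sub_mem O.one_mem hf, ?_⟩
    ext y
    by_cases hy : y = x
    · subst hy; simp [hx]
    · simp [hy, h y hy]
  have hclosed : IsClosed ({x} : Set X) := by
    refine ⟨TopologicalSpace.isOpen_generateFrom_of_mem ⟨f, hf, ?_⟩⟩
    ext y
    by_cases hy : y = x
    · subst hy; simp [hx]
    · simp [hy, h y hy]
  have hconn : connectedComponent x = {x} :=
    (IsClopen.connectedComponent_subset ⟨hclosed, hopen⟩ rfl).antisymm
      (Set.singleton_subset_iff.2 mem_connectedComponent)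
  refine ⟨hopen, ⟨isIrreducible_singleton, fun s hs hxs => ?_⟩, hconn⟩
  rw [← hconn]
  exact hs.isPreirreducible.isPreconnected.subset_connectedComponent (hxs rfl)

end IsolatedComponent

theorem coe_mem_endRegular {K : Type u} [Field K] {A : Type v} [NonUnitalNonAssocRing A]
    [Module K A] (l : Module.Dual K (Module.End K A)) :
    (fun σ : algEnd K A => l (σ : Module.End K A)) ∈ endRegular K A :=
  Algebra.subset_adjoin ⟨l, rfl⟩

/-- A map into the endomorphisms is a morphism if its matrix coefficients are regular. -/
theorem isMorphism_endRegular {K : Type u} [Field K] {A : Type v} [NonUnitalNonAssocRing A]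
    [Module K A] [FiniteDimensional K A] {X : Type w} {O : Subalgebra K (X → K)}
    {φ : X → algEnd K A}
    (h : ∀ (ξ : Module.Dual K A) (a : A), (fun x => ξ ((φ x : Module.End K A) a)) ∈ O) :
    IsMorphism O (endRegular K A) φ := by
  have : endRegular K A ≤ O.comap (pullback K φ) := by
    refine Algebra.adjoin_le ?_
    rintro _ ⟨l, rfl⟩
    change (fun x => l (φ x : Module.End K A)) ∈ O
    let b := Module.finBasis K A
    -- A linear functional on operators is a combination of matrix entries.
    have hl : (fun x => l (φ x : Module.End K A)) = ∑ i, ∑ j,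
        l (Matrix.toLin b b (Matrix.single i j 1)) •
          fun x => b.coord i ((φ x : Module.End K A) (b j)) := by
      ext x
      conv_lhs => rw [← Matrix.toLin_toMatrix b b (φ x : Module.End K A),
        Matrix.matrix_eq_sum_single (LinearMap.toMatrix b b (φ x : Module.End K A))]
      simp only [map_sum, Finset.sum_apply, Pi.smul_apply, smul_eq_mul]
      refine Finset.sum_congr rfl fun i _ => Finset.sum_congr rfl fun j _ => ?_
      rw [LinearMap.toMatrix_apply, ← mul_one (b.repr _ i), ← smul_eq_mul, ← Matrix.smul_single,
        map_smul, map_smul, smul_eq_mul, mul_comm]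
      simp
    rw [hl]
    exact O.sum_mem fun i _ => O.sum_mem fun j _ => O.smul_mem (h _ _) _
  exact fun f hf => this hf

theorem exists_mulEquiv_of_bijective {K : Type u} [Field K] {X : Type v} {Y : Type w} [MulOneClass X]
    [MulOneClass Y] {OX : Subalgebra K (X → K)} {OY : Subalgebra K (Y → K)} (θ : X →* Y)
    (hθ : Function.Bijective θ) (h : IsMorphism OX OY θ)
    (h' : ∀ f ∈ OX, ∃ F ∈ OY, ∀ x, F (θ x) = f x) :
    ∃ φ : X ≃* Y, (∀ x, φ x = θ x) ∧ IsMorphism OX OY φ ∧ IsMorphism OY OX φ.symm := by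
  refine ⟨MulEquiv.ofBijective θ hθ, fun _ => rfl, h, fun f hf => ?_⟩
  obtain ⟨F, hF, hFf⟩ := h' f hf
  have : f ∘ (MulEquiv.ofBijective θ hθ).symm = F := by
    funext σ
    rw [Function.comp_apply, ← hFf]
    exact congrArg F ((MulEquiv.ofBijective θ hθ).apply_symm_apply σ)
  rwa [this]

/-! ### The isomorphism from the monoid with zero -/

section Main

variable {K : Type u} [Field K] {M : Type v} [Monoid M] {D E : Type u} [AddCommGroup D] [Module K D]
  [AddCommGroup E] [Module K E] [FiniteDimensional K D]
  {V : Submodule K (M → K)} (hV : IsBiinvariant V) (h1 : 1 ∈ V) (i : D ≃ₗ[K] V)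
  (i' : E ≃ₗ[K] ↥(V * V)) {ev : ℕ → K}
  (hev : Function.Injective ev) (h0 : ∀ n, ev n ≠ 0) (h1' : ∀ n, ev n ≠ 1)

/-- The monoid acts on the algebra of a window by right translations. -/
noncomputable def translationEnd (m : M) :
    algEnd K (windowData hV h1 i i' ev hev h0 h1').Alg :=
  ⟨_, (isCompatible_rightTranslation hV h1 i i' hev h0 h1' m).extend_mem_algEnd⟩

theorem translationEnd_coe_apply (m : M) (a : (windowData hV h1 i i' ev hev h0 h1').Alg) :
    (translationEnd hV h1 i i' hev h0 h1' m : Module.End K _) a =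
      ⟨a.e, a.u, a.t, rightTranslation hV i m a.d, rightTranslation (hV.mul hV) i' m a.h⟩ := rfl

/-- The monoid with a zero acts on the algebra of a window. -/
noncomputable def withZeroHom :
    WithZero M →* algEnd K (windowData hV h1 i i' ev hev h0 h1').Alg where
  toFun := WithZero.recZeroCoe (zeroEnd K _) (translationEnd hV h1 i i' hev h0 h1')
  map_one' := by
    refine Subtype.ext (LinearMap.ext fun a => ?_)
    change (translationEnd hV h1 i i' hev h0 h1' 1 : Module.End K _) a = a
    rw [translationEnd_coe_apply, rightTranslation_one, rightTranslation_one]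
    rfl
  map_mul' x y := by
    refine Subtype.ext (LinearMap.ext fun a => ?_)
    induction x using WithZero.recZeroCoe with
    | zero => rw [zero_mul]; rfl
    | coe x =>
      induction y using WithZero.recZeroCoe with
      | zero =>
        rw [mul_zero]
        exact (map_zero (translationEnd hV h1 i i' hev h0 h1' x).1).symm
      | coe y =>
        rw [← WithZero.coe_mul]
        change (translationEnd hV h1 i i' hev h0 h1' (x * y) : Module.End K _) a =
          (translationEnd hV h1 i i' hev h0 h1' x : Module.End K _)
            ((translationEnd hV h1 i i' hev h0 h1' y : Module.End K _) a)
        simp only [translationEnd_coe_apply, rightTranslation_mul, LinearMap.comp_apply]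

theorem withZeroHom_zero : withZeroHom hV h1 i i' hev h0 h1' 0 = zeroEnd K _ := rfl

theorem withZeroHom_coe (m : M) :
    withZeroHom hV h1 i i' hev h0 h1' m = translationEnd hV h1 i i' hev h0 h1' m := rfl

variable {O : Subalgebra K (M → K)} (hW : IsWindow O V)

/-- The function on endomorphisms that is `0` at zero and `1` elsewhere. -/
noncomputable def idemCoeff (S : RigidData K k D E) : Module.Dual K (Module.End K S.Alg) :=
  S.coeffE ∘ₗ LinearMap.applyₗ S.idem

theorem idemCoeff_translationEnd (m : M) :
    idemCoeff (windowData hV h1 i i' ev hev h0 h1') (translationEnd hV h1 i i' hev h0 h1' m).1 = 1 :=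
  rfl

theorem translationEnd_ne_zero (m : M) :
    translationEnd hV h1 i i' hev h0 h1' m ≠ zeroEnd K _ := by
  intro h
  have := idemCoeff_translationEnd hV h1 i i' hev h0 h1' m
  rw [h] at this
  exact zero_ne_one ((map_zero (idemCoeff _)).symm.trans this)

include hW in
theorem withZeroHom_bijective (hO : Function.Injective (evalAt O)) :
    Function.Bijective (withZeroHom hV h1 i i' hev h0 h1') := by
  constructor
  · intro x y hxy
    induction x using WithZero.recZeroCoe with
    | zero =>
      induction y using WithZero.recZeroCoe with
      | zero => rfl
      | coe y => exact absurd hxy.symm (translationEnd_ne_zero hV h1 i i' hev h0 h1' y)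
    | coe x =>
      induction y using WithZero.recZeroCoe with
      | zero => exact absurd hxy (translationEnd_ne_zero hV h1 i i' hev h0 h1' x)
      | coe y =>
        have hg : rightTranslation hV i x = rightTranslation hV i y :=
          RigidData.extend_injective (congrArg Subtype.val hxy)
        have hVxy : ∀ f ∈ V, f x = f y := fun f hf => by
          have := congrArg (fun g => (i (g (i.symm ⟨f, hf⟩)) : M → K) 1) hg
          simpa [rightTranslation_apply] using this
        have hle : O ≤ AlgHom.equalizer (Pi.evalAlgHom K (fun _ : M => K) x)
            (Pi.evalAlgHom K (fun _ : M => K) y) := by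
          rw [← hW.adjoin_eq]
          exact Algebra.adjoin_le hVxy
        exact congrArg _ (hO (AlgHom.ext fun f => hle f.2))
  · rintro ⟨σ, hσ⟩
    rcases RigidData.eq_zero_or_exists_eq_extend hσ with rfl | ⟨g, g', hg, rfl⟩
    · exact ⟨0, rfl⟩
    · obtain ⟨m, rfl, rfl⟩ := exists_eq_rightTranslation hV h1 i i' hev h0 h1' hW hg
      exact ⟨m, rfl⟩

include hW in
theorem isMorphism_withZeroHom [FiniteDimensional K E] :
    IsMorphism (withZeroRegular O) (endRegular K _) (withZeroHom hV h1 i i' hev h0 h1') := by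
  refine isMorphism_endRegular fun ξ a => ?_
  change (fun m => ξ ((translationEnd hV h1 i i' hev h0 h1' m : Module.End K _) a)) ∈ O
  have hVO := hW.le_toSubmodule
  have h₁ := coeff_rightTranslation_mem hV hVO i (ξ ∘ₗ RigidData.inD _) a.d
  have h₂ := coeff_rightTranslation_mem (hV.mul hV) (mul_le_toSubmodule hVO hVO) i'
    (ξ ∘ₗ RigidData.inE _) a.h
  have h₃ := O.algebraMap_mem (ξ ⟨a.e, a.u, a.t, 0, 0⟩)
  convert O.add_mem (O.add_mem h₃ h₁) h₂ using 1
  ext m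
  simp only [Pi.add_apply, LinearMap.comp_apply, Pi.algebraMap_apply, Algebra.algebraMap_self,
    RingHom.id_apply, ← map_add, translationEnd_coe_apply]
  congr 1
  ext <;> simp [RigidData.inD, RigidData.inE]

include hW in
-- For `f` in `V`, the value `f(m) = (R_m f)(1)` is a linear functional of the operator, and `V`
-- generates `O`.
theorem exists_mem_endRegular_translationEnd_eq {f : M → K} (hf : f ∈ O) :
    ∃ F ∈ endRegular K _, ∀ m, F (translationEnd hV h1 i i' hev h0 h1' m) = f m := by
  have : O ≤ (endRegular K _).map (pullback K (translationEnd hV h1 i i' hev h0 h1')) := by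
    rw [← hW.adjoin_eq]
    refine Algebra.adjoin_le fun f hf => ?_
    refine ⟨_, coe_mem_endRegular ((LinearMap.proj 1 ∘ₗ V.subtype ∘ₗ i.toLinearMap) ∘ₗ
      RigidData.prD _ ∘ₗ LinearMap.applyₗ (RigidData.inD _ (i.symm ⟨f, hf⟩))), funext fun m => ?_⟩
    change (i (rightTranslation hV i m (i.symm ⟨f, hf⟩)) : M → K) 1 = f m
    simp [rightTranslation_apply]
  obtain ⟨F, hF, rfl⟩ := this hf
  exact ⟨F, hF, fun m => rfl⟩

include hW in
theorem exists_mem_endRegular_withZeroHom_eq {f : WithZero M → K} (hf : f ∈ withZeroRegular O) :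
    ∃ F ∈ endRegular K _, ∀ x, F (withZeroHom hV h1 i i' hev h0 h1' x) = f x := by
  obtain ⟨F, hF, hFf⟩ :=
    exists_mem_endRegular_translationEnd_eq hV h1 i i' hev h0 h1' hW (f := fun m : M => f m) hf
  have hε := coe_mem_endRegular (idemCoeff (windowData hV h1 i i' ev hev h0 h1'))
  -- With `ε` the idempotent coefficient, the function `ε F + f(0) (1 - ε)` glues `F` on `M` to the
  -- value of `f` at the adjoined zero.
  refine ⟨_, Subalgebra.add_mem _ (Subalgebra.mul_mem _ hε hF)
    (Subalgebra.smul_mem _ (Subalgebra.sub_mem _ (Subalgebra.one_mem _) hε) (f 0)), fun x => ?_⟩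
  simp only [Pi.add_apply, Pi.mul_apply, Pi.smul_apply, Pi.sub_apply, Pi.one_apply, smul_eq_mul]
  induction x using WithZero.recZeroCoe with
  | zero =>
    have hz : idemCoeff (windowData hV h1 i i' ev hev h0 h1') (zeroEnd K _).1 = 0 := map_zero _
    rw [withZeroHom_zero, hz]
    ring
  | coe m =>
    rw [withZeroHom_coe, idemCoeff_translationEnd, hFf]
    ring

theorem isIsolatedComponent_zeroEnd
    (h : Function.Surjective (withZeroHom hV h1 i i' hev h0 h1')) :
    IsIsolatedComponent (endRegular K (windowData hV h1 i i' ev hev h0 h1').Alg) (zeroEnd K _) := by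
  refine isIsolatedComponent_of_mem (coe_mem_endRegular (idemCoeff _)) (map_zero _) fun σ hσ => ?_
  obtain ⟨x, rfl⟩ := h σ
  induction x using WithZero.recZeroCoe with
  | zero => exact absurd (withZeroHom_zero hV h1 i i' hev h0 h1') hσ
  | coe m => exact idemCoeff_translationEnd hV h1 i i' hev h0 h1' m

end Main

end AffMon

theorem theorem1 {K : Type u} [Field K] [IsAlgClosed K] {M : Type v} [Monoid M]
    (O : Subalgebra K (M → K)) (hM : AffMon.IsAffineAlgebraicMonoid O) :
    ∃ (A : Type u) (_ : NonUnitalNonAssocRing A) (_ : Module K A)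
      (_ : IsScalarTower K A A) (_ : SMulCommClass K A A),
      FiniteDimensional K A ∧
      (∃ φ : WithZero M ≃* AffMon.algEnd K A,
        φ 0 = AffMon.zeroEnd K A ∧
        AffMon.IsMorphism (AffMon.withZeroRegular O) (AffMon.endRegular K A) φ ∧
        AffMon.IsMorphism (AffMon.endRegular K A) (AffMon.withZeroRegular O) φ.symm) ∧
      AffMon.IsIsolatedComponent (AffMon.endRegular K A) (AffMon.zeroEnd K A) := by
  open AffMon in
  obtain ⟨V, hW⟩ := exists_isWindow hM
  have hV := hW.isBiinvariant
  have : FiniteDimensional K V := Module.Finite.of_fg hW.fg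
  have : FiniteDimensional K ↥(V * V) := Module.Finite.of_fg (hW.fg.mul hW.fg)
  have : Infinite K := IsAlgClosed.instInfinite
  -- Algebraically closed fields are infinite, which supplies distinct eigenvalues avoiding 0 and 1.
  let emb := (Set.Finite.infinite_compl (Set.toFinite ({0, 1} : Set K))).natEmbedding
  have hev : Function.Injective fun n => (emb n : K) := fun a b h => emb.injective (Subtype.ext h)
  have h0 : ∀ n, (emb n : K) ≠ 0 := fun n h => (emb n).2 (by simp [h])
  have h1' : ∀ n, (emb n : K) ≠ 1 := fun n h => (emb n).2 (by simp [h])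
  -- Coordinate spaces replace `V` and `V * V`, whose universe also involves that of `M`, so that
  -- the algebra lies in the universe of `K`.
  obtain ⟨i⟩ : Nonempty ((Fin (Module.finrank K V) → K) ≃ₗ[K] V) :=
    ⟨(Module.finBasis K V).equivFun.symm⟩
  obtain ⟨i'⟩ : Nonempty ((Fin (Module.finrank K ↥(V * V)) → K) ≃ₗ[K] ↥(V * V)) :=
    ⟨(Module.finBasis K ↥(V * V)).equivFun.symm⟩
  have hbij := withZeroHom_bijective hV hW.one_mem i i' hev h0 h1' hW
    hM.isAffineVariety.bijective_evalAt.injective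
  obtain ⟨φ, hφ, hφ', hφ''⟩ := exists_mulEquiv_of_bijective _ hbij
    (isMorphism_withZeroHom hV hW.one_mem i i' hev h0 h1' hW)
    (fun f hf => exists_mem_endRegular_withZeroHom_eq hV hW.one_mem i i' hev h0 h1' hW hf)
  exact ⟨(windowData hV hW.one_mem i i' _ hev h0 h1').Alg, inferInstance, inferInstance,
    inferInstance, inferInstance, inferInstance, ⟨φ, hφ 0, hφ', hφ''⟩,
    isIsolatedComponent_zeroEnd hV hW.one_mem i i' hev h0 h1' hbij.surjective⟩
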